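/- All graphs are finite, simple and undirected, and $N[v]$ denotes the set consisting of a vertex $v$ and its neighbors. In the Staller-start domination game on a graph $G$, two players, Staller and Dominator, alternately select vertices of $G$, with Staller moving first. The $i$-th selected vertex $v_i$ must dominate at least one new vertex, that is, $N[v_i]\setminus\bigcup_{j<i}N[v_j]\neq\emptyset$. The game ends as soon as the closed neighborhoods of the selected vertices cover $V(G)$. Dominator aims to minimize the total number of moves and Staller aims to maximize it; the Staller-start game domination number $\gamma_g'(G)$ is the total number of moves when both play optimally. Theorem. Let $G$ be a graph on $n$ vertices without isolated vertices. Then $$\gamma_g'(G)\le\frac{5n+2}{8}.$$ -/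

import Mathlib

namespace DominationGame

/-- The closed neighborhood `N[v]`: the vertex `v` together with its neighbors. -/
def closedNbhd {V : Type*} (G : SimpleGraph V) (v : V) : Set V :=
  insert v (G.neighborSet v)

/-- `N[D]`, the set of vertices dominated by the vertices of `D`. -/
def dominated {V : Type*} (G : SimpleGraph V) (D : Set V) : Set V :=
  ⋃ v ∈ D, closedNbhd G v

/-- When `D` is the set of vertices played so far, playing `v` is legal if `v` dominates at
least one new vertex. -/
def IsLegal {V : Type*} (G : SimpleGraph V) (D : Set V) (v : V) : Prop :=
  (closedNbhd G v \ dominated G D).Nonempty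

/-- The two players. -/
inductive Player where
  | dominator
  | staller

theorem IsLegal.notMem {V : Type*} {G : SimpleGraph V} {D : Set V} {v : V}
    (h : IsLegal G D v) : v ∉ D := by
  obtain ⟨u, hu, hD⟩ := h
  exact fun hv => hD (Set.mem_biUnion hv hu)

theorem IsLegal.ncard_compl_insert_lt {V : Type*} [Finite V] {G : SimpleGraph V} {D : Set V}
    {v : V} (h : IsLegal G D v) : (insert v D)ᶜ.ncard < Dᶜ.ncard := by
  refine Set.ncard_lt_ncard ⟨Set.compl_subset_compl.mpr (Set.subset_insert v D), ?_⟩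
    (Set.toFinite _)
  exact fun hs => hs h.notMem (Set.mem_insert v D)

open Classical in
/-- The number of moves still to be made under optimal play, when `D` is the set of vertices
played so far and the given player is to move. The game is over once every vertex is dominated.
Otherwise some legal move exists (any undominated vertex is one); Dominator chooses a legal move
minimizing, and Staller a legal move maximizing, the number of remaining moves. (The minimum and
the maximum are over a finite nonempty set of natural numbers.) -/
noncomputable def movesLeft {V : Type*} [Finite V] (G : SimpleGraph V) :
    Player → Set V → ℕ
  | .dominator, D =>
      if dominated G D = Set.univ then 0
      else 1 + ⨅ v : {v : V // IsLegal G D v}, movesLeft G .staller (insert v.1 D)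
  | .staller, D =>
      if dominated G D = Set.univ then 0
      else 1 + ⨆ v : {v : V // IsLegal G D v}, movesLeft G .dominator (insert v.1 D)
termination_by _ D => Dᶜ.ncard
decreasing_by
  · exact v.2.ncard_compl_insert_lt
  · exact v.2.ncard_compl_insert_lt

/-- The Staller-start game domination number `γ_g'(G)`: the number of moves in the domination
game on `G` when Staller makes the first move and both players play optimally. -/
noncomputable def stallerStartNumber {V : Type*} [Finite V] (G : SimpleGraph V) : ℕ :=
  movesLeft G .staller ∅

/-- A graph is isolate-free if it has no isolated vertex. -/
def IsolateFree {V : Type*} (G : SimpleGraph V) : Prop :=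
  ∀ v : V, ¬ G.IsIsolated v

end DominationGame

namespace DominationGame

/-! Vertices get weights such that, with Dominator to move, eight times the number of remaining
moves is at most the total weight. For this it is enough that a move of Dominator and Staller's
reply together remove 16. Every Staller move removes at least 5, so Dominator looks for a move
removing 11.

Opening: the weights are 5 for an undominated vertex, 4 for a dominated one with an undominated
neighbor, and 0 otherwise. While an undominated leaf hangs on an undominated vertex `u` that has a
further undominated neighbor, playing `u` removes 5 + 5 + 1. Once the position is `Clean`, it stays
so, and the smaller weights `wt` take over (`potential_le_coarsePotential`).

Clean positions (`Clean.domBound`): suppose no move removes 11 (`Stuck`). Then the undominated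
vertices induce a matching plus isolated vertices. If there is an edge, playing an end of it removes
10, and by `Stuck.reply` either Staller's answer removes 6, or Dominator's next move removes 12. The
accounts are 10 + 6 = 16 and 10 + 5 + 12 + 5 = 32. If there is no edge, each undominated vertex
forms with its neighbors a separate component of weight at least 8, so every move removes 8.

The initial weight is 5n. Staller's first move removes at least 6 but costs 8, which gives the
additive 2. -/

variable {V : Type*} (G : SimpleGraph V)

/-! ### Residual positions and weights -/

open Classical in
/-- The vertices of `U` that remain undominated after `m` is played. -/
noncomputable def after (U : Finset V) (m : V) : Finset V :=
  U.filter fun v => v ≠ m ∧ ¬ G.Adj m v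

/-- A vertex with at most one neighbor. -/
def IsLeaf (z : V) : Prop :=
  ∀ a b, G.Adj z a → G.Adj z b → a = b

/-- A vertex with a neighbor that is an undominated leaf. -/
def IsSupport (U : Finset V) (v : V) : Prop :=
  ∃ z ∈ U, IsLeaf G z ∧ G.Adj v z

/-- An undominated vertex of degree at least two forming a component of the residual graph
together with its neighbors. -/
def IsCenter (U : Finset V) (x : V) : Prop :=
  ¬ IsLeaf G x ∧ ∀ c, G.Adj x c → c ∉ U ∧ ∀ q ∈ U, G.Adj c q → q = x

open Classical in
/-- The number of undominated neighbors that are leaves or supports. -/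
noncomputable def leafiness (U : Finset V) (b : V) : ℕ :=
  (U.filter fun q => G.Adj b q ∧ (IsLeaf G q ∨ IsSupport G U q)).card

open Classical in
/-- The weight of a vertex when `U` is the set of undominated vertices. -/
noncomputable def wt (U : Finset V) (v : V) : ℕ :=
  if v ∈ U then (if IsCenter G U v then 4 else 5)
  else if ∃ q ∈ U, G.Adj v q then 2 + min 2 (leafiness G U v) else 0

open Classical in
/-- The weight of a vertex in the opening phase. -/
noncomputable def coarseWt (U : Finset V) (v : V) : ℕ :=
  if v ∈ U then 5 else if ∃ q ∈ U, G.Adj v q then 4 else 0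

/-- No undominated leaf has an undominated neighbor with a further undominated neighbor. -/
def Clean (U : Finset V) : Prop :=
  ∀ u ∈ U, ∀ z ∈ U, IsLeaf G z → G.Adj u z → ∀ v ∈ U, G.Adj u v → v = z

/-- A move is legal if it dominates a vertex of `U`. -/
def Legal (U : Finset V) (m : V) : Prop := ∃ v ∈ U, v = m ∨ G.Adj m v

variable {G} {U U' : Finset V} {m u v : V} {w w' : ℕ}

theorem mem_after : v ∈ after G U m ↔ v ∈ U ∧ v ≠ m ∧ ¬ G.Adj m v := by
  classical simp [after]

theorem after_subset : after G U m ⊆ U := fun _ hv => (mem_after.1 hv).1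

theorem Legal.card_after_lt (h : Legal G U m) : (after G U m).card < U.card := by
  obtain ⟨v, hv, h⟩ := h
  refine Finset.card_lt_card ⟨after_subset, fun hs => ?_⟩
  have := mem_after.1 (hs hv)
  tauto

theorem exists_legal (h : U.Nonempty) : ∃ m, Legal G U m :=
  let ⟨v, hv⟩ := h
  ⟨v, v, hv, Or.inl rfl⟩

/-! ### Weights along a move -/

theorem wt_of_mem (h : v ∈ U) (h' : ¬ IsCenter G U v) : wt G U v = 5 := by simp [wt, h, h']

theorem wt_of_adj (h : v ∈ U) {x : V} (hx : x ∈ U) (hvx : G.Adj v x) : wt G U v = 5 :=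
  wt_of_mem h fun hc => (hc.2 x hvx).1 hx

theorem four_le_wt (h : v ∈ U) : 4 ≤ wt G U v := by
  simp only [wt, h, if_true]; split_ifs <;> omega

theorem wt_of_isCenter (h : v ∈ U) (h' : IsCenter G U v) : wt G U v = 4 := by simp [wt, h, h']

theorem wt_eq_of_notMem (h : v ∉ U) {q : V} (hq : q ∈ U) (hvq : G.Adj v q) :
    wt G U v = 2 + min 2 (leafiness G U v) := by
  simp only [wt, h, if_false]
  rw [if_pos ⟨q, hq, hvq⟩]

theorem two_le_wt {q : V} (hq : q ∈ U) (hvq : G.Adj v q) : 2 ≤ wt G U v := by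
  by_cases h : v ∈ U
  · have := four_le_wt (G := G) h; omega
  · rw [wt_eq_of_notMem h hq hvq]; omega

theorem wt_eq_zero (h : v ∉ U) (h' : ∀ q ∈ U, ¬ G.Adj v q) : wt G U v = 0 := by
  simp only [wt, h, if_false]
  rw [if_neg]; push Not; exact h'

theorem wt_after_self : wt G (after G U m) m = 0 := by
  refine wt_eq_zero (fun h => (mem_after.1 h).2.1 rfl) fun q hq => (mem_after.1 hq).2.2

theorem IsSupport.mono (h : U' ⊆ U) (hs : IsSupport G U' v) : IsSupport G U v :=
  let ⟨z, hz, hl, ha⟩ := hs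
  ⟨z, h hz, hl, ha⟩

theorem Clean.mono (hU : Clean G U) (h : U' ⊆ U) : Clean G U' :=
  fun u hu z hz hl ha v hv hav => hU u (h hu) z (h hz) hl ha v (h hv) hav

theorem leafiness_mono (h : U' ⊆ U) : leafiness G U' v ≤ leafiness G U v := by
  classical
  refine Finset.card_le_card fun q hq => ?_
  simp only [Finset.mem_filter] at hq ⊢
  exact ⟨h hq.1, hq.2.1, hq.2.2.imp_right (IsSupport.mono h)⟩

theorem leafiness_pos {q : V} (hq : q ∈ U) (h : G.Adj v q) (h' : IsLeaf G q ∨ IsSupport G U q) :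
    1 ≤ leafiness G U v :=
  Finset.card_pos.2 ⟨q, by simp [hq, h, h']⟩

theorem IsCenter.mono (h : U' ⊆ U) (hc : IsCenter G U v) : IsCenter G U' v :=
  ⟨hc.1, fun c ha => ⟨fun hU => (hc.2 c ha).1 (h hU), fun q hq => (hc.2 c ha).2 q (h hq)⟩⟩

/-- In a clean position only a support can get weight three when it is dominated. -/
theorem Clean.leafiness_eq_zero (hU : Clean G U) (h : U' ⊆ U) (hv : v ∈ U)
    (hv' : v ∉ U') (hs : ¬ IsSupport G U v) : leafiness G U' v = 0 := by
  classical
  refine Finset.card_eq_zero.2 (Finset.filter_eq_empty_iff.2 ?_)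
  rintro q hq ⟨ha, hl | ⟨z, hz, hl, haz⟩⟩
  · exact hs ⟨q, h hq, hl, ha⟩
  · have := hU q (h hq) z (h hz) hl haz v hv ha.symm
    exact hv' (this ▸ hz)

theorem Clean.leafiness_le_one (hU : Clean G U) (h : U' ⊆ U) (hv : v ∈ U)
    (hv' : v ∉ U') : leafiness G U' v ≤ 1 := by
  classical
  by_cases hs : IsSupport G U v
  · obtain ⟨z, hz, hl, ha⟩ := hs
    refine Finset.card_le_one.2 ?_
    intro a ha' b hb'
    simp only [Finset.mem_filter] at ha' hb'
    rw [hU v hv z hz hl ha a (h ha'.1) ha'.2.1, hU v hv z hz hl ha b (h hb'.1) hb'.2.1]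
  · rw [hU.leafiness_eq_zero h hv hv' hs]; omega

theorem wt_le_of_notMem (hv : v ∉ U) : wt G U v ≤ 2 + min 2 (leafiness G U v) := by
  simp only [wt, hv, if_false]; split_ifs <;> omega

theorem Clean.wt_add_two_le (hU : Clean G U) (h : U' ⊆ U) (hv : v ∈ U)
    (hv' : v ∉ U') : wt G U' v + 2 ≤ wt G U v := by
  by_cases hc : IsCenter G U v
  · have := four_le_wt (G := G) hv
    rw [wt_eq_zero hv' fun q hq ha => (hc.2 q ha).1 (h hq)]; omega
  · have := wt_le_of_notMem (G := G) hv'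
    have := hU.leafiness_le_one h hv hv'
    rw [wt_of_mem hv hc]; omega

theorem Clean.wt_add_three_le (hU : Clean G U) (h : U' ⊆ U) (hv : v ∈ U)
    (hv' : v ∉ U') (hs : ¬ IsSupport G U v) : wt G U' v + 3 ≤ wt G U v := by
  by_cases hc : IsCenter G U v
  · have := four_le_wt (G := G) hv
    rw [wt_eq_zero hv' fun q hq ha => (hc.2 q ha).1 (h hq)]; omega
  · have := wt_le_of_notMem (G := G) hv'
    have := hU.leafiness_eq_zero h hv hv' hs
    rw [wt_of_mem hv hc]; omega

/-- The critical case is a newly dominated vertex: cleanness caps its leafiness at one, so 5 drops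
to at most 3, while a center drops from 4 to 0. -/
theorem Clean.wt_mono (hU : Clean G U) (h : U' ⊆ U) (v : V) : wt G U' v ≤ wt G U v := by
  by_cases hv : v ∈ U
  · by_cases hv' : v ∈ U'
    · simp only [wt, hv, hv', if_true]
      by_cases hc : IsCenter G U v
      · simp [hc, hc.mono h]
      · simp only [hc, if_false]; split_ifs <;> omega
    · have := hU.wt_add_two_le h hv hv'; omega
  · have hv' : v ∉ U' := fun h' => hv (h h')
    by_cases hq : ∃ q ∈ U', G.Adj v q
    · obtain ⟨q, hq, ha⟩ := hq
      rw [wt_eq_of_notMem hv' hq ha, wt_eq_of_notMem hv (h hq) ha]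
      have := leafiness_mono (G := G) (v := v) h
      omega
    · push Not at hq
      rw [wt_eq_zero hv' hq]; omega

theorem mem_after_iff_notMem_dominated {D : Set V} (hD : ∀ v, v ∈ U ↔ v ∉ dominated G D) (v : V) :
    v ∈ after G U m ↔ v ∉ dominated G (insert m D) := by
  rw [mem_after, hD]
  have h : dominated G (insert m D) = closedNbhd G m ∪ dominated G D := Set.biUnion_insert _ _ _
  rw [h, Set.mem_union, closedNbhd, Set.mem_insert_iff, SimpleGraph.mem_neighborSet]
  tauto

theorem legal_iff_isLegal {D : Set V} (hD : ∀ v, v ∈ U ↔ v ∉ dominated G D) :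
    Legal G U m ↔ IsLegal G D m := by
  simp only [Legal, IsLegal, Set.Nonempty, Set.mem_sdiff, closedNbhd, Set.mem_insert_iff,
    SimpleGraph.mem_neighborSet, ← hD, and_comm]

variable (G) in
/-- Every undominated vertex has at most one undominated neighbor. -/
def Matched (U : Finset V) : Prop :=
  ∀ v ∈ U, ∀ a ∈ U, ∀ b ∈ U, G.Adj v a → G.Adj v b → a = b

theorem Matched.wt_after_eq_zero (hM : Matched G U) {u : V} (hu : u ∈ U) (hv : v ∈ U)
    (huv : G.Adj u v) : wt G (after G U u) v = 0 := by
  refine wt_eq_zero (fun h => (mem_after.1 h).2.2 huv) fun q hq hvq => ?_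
  exact (mem_after.1 hq).2.1 (hM v hv q (after_subset hq) u hu hvq huv.symm)

theorem Matched.not_isSupport (hM : Matched G U) {a : V} (hv : v ∈ U) (ha : a ∈ U)
    (hva : G.Adj v a) (hl : ¬ IsLeaf G a) : ¬ IsSupport G U v := by
  rintro ⟨z, hz, hlz, hvz⟩
  exact hl (hM v hv a ha z hz hva hvz ▸ hlz)

theorem coarseWt_mono (h : U' ⊆ U) (v : V) : coarseWt G U' v ≤ coarseWt G U v := by
  by_cases hv : v ∈ U
  · simp only [coarseWt, hv, if_true]
    split_ifs <;> omega
  · have hv' : v ∉ U' := fun h' => hv (h h')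
    simp only [coarseWt, hv, hv', if_false]
    by_cases hq : ∃ q ∈ U', G.Adj v q
    · obtain ⟨q, hq, ha⟩ := hq
      rw [if_pos ⟨q, hq, ha⟩, if_pos ⟨q, h hq, ha⟩]
    · rw [if_neg hq]
      omega

theorem coarseWt_eq_zero (h : v ∉ U) (h' : ∀ q ∈ U, ¬ G.Adj v q) : coarseWt G U v = 0 := by
  simp only [coarseWt, h, if_false]
  rw [if_neg]
  push Not
  exact h'

theorem coarseWt_of_mem (h : v ∈ U) : coarseWt G U v = 5 := by
  simp [coarseWt, h]

theorem coarseWt_le_four (h : v ∉ U) : coarseWt G U v ≤ 4 := by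
  simp only [coarseWt, h, if_false]
  split_ifs <;> omega

theorem coarseWt_after_self : coarseWt G (after G U m) m = 0 :=
  coarseWt_eq_zero (fun h => (mem_after.1 h).2.1 rfl) fun _ hq => (mem_after.1 hq).2.2

/-! ### Potentials and bounds on the number of moves -/

variable (G) [Fintype V]

/-- The total weight. -/
noncomputable def potential (U : Finset V) : ℕ := ∑ v, wt G U v

/-- The total weight in the opening phase. -/
noncomputable def coarsePotential (U : Finset V) : ℕ := ∑ v, coarseWt G U v

/-- With `U` undominated and Dominator to move, eight times the number of moves is at most `w`. -/
def DomBound (U : Finset V) (w : ℕ) : Prop :=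
  ∀ D : Set V, (∀ v, v ∈ U ↔ v ∉ dominated G D) → 8 * movesLeft G .dominator D ≤ w

/-- With `U` undominated and Staller to move, eight times the number of moves is at most `w`. -/
def StallBound (U : Finset V) (w : ℕ) : Prop :=
  ∀ D : Set V, (∀ v, v ∈ U ↔ v ∉ dominated G D) → 8 * movesLeft G .staller D ≤ w

variable {G}

theorem stallBound_empty : StallBound G ∅ w := by
  intro D hD
  have : dominated G D = Set.univ := by
    ext v; have := hD v; simp at this; simp [this]
  rw [movesLeft, if_pos this]; simp

theorem domBound_empty : DomBound G ∅ w := by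
  intro D hD
  have : dominated G D = Set.univ := by
    ext v; have := hD v; simp at this; simp [this]
  rw [movesLeft, if_pos this]; simp

theorem StallBound.domBound (hm : Legal G U m) (h : StallBound G (after G U m) w')
    (hw : w' + 8 ≤ w) : DomBound G U w := by
  intro D hD
  rw [movesLeft]
  split_ifs
  · simp
  · have h1 := h _ (mem_after_iff_notMem_dominated hD)
    have h2 : ⨅ v : {v : V // IsLegal G D v}, movesLeft G .staller (insert v.1 D) ≤
        movesLeft G .staller (insert m D) :=
      ciInf_le (OrderBot.bddBelow _) (⟨m, (legal_iff_isLegal hD).1 hm⟩ : {v : V // IsLegal G D v})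
    omega

theorem DomBound.mono (h : DomBound G U w') (hw : w' ≤ w) : DomBound G U w :=
  fun D hD => (h D hD).trans hw

theorem stallBound_of_forall
    (h : ∀ m, Legal G U m → ∃ w', DomBound G (after G U m) w' ∧ w' + 8 ≤ w) :
    StallBound G U w := by
  rcases U.eq_empty_or_nonempty with rfl | hU
  · exact stallBound_empty
  intro D hD
  rw [movesLeft]
  split_ifs
  · simp
  · have h2 : ⨆ v : {v : V // IsLegal G D v}, movesLeft G .dominator (insert v.1 D) ≤
        (w - 8) / 8 := by
      refine ciSup_le' fun v => ?_
      obtain ⟨w', h1, h2⟩ := h v ((legal_iff_isLegal hD).2 v.2)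
      have := h1 _ (mem_after_iff_notMem_dominated hD)
      omega
    -- Some legal move is needed to get `8 ≤ w`, since the subtraction `w - 8` truncates.
    obtain ⟨m, hm⟩ := exists_legal (G := G) hU
    obtain ⟨w', -, hw⟩ := h m hm
    omega

theorem sum_add_le_sum {f g : V → ℕ} (h : ∀ v, f v ≤ g v) (T : Finset V) {k : ℕ}
    (hT : ∑ v ∈ T, f v + k ≤ ∑ v ∈ T, g v) : ∑ v, f v + k ≤ ∑ v, g v := by
  classical
  have h1 := Finset.sum_add_sum_compl T f
  have h2 := Finset.sum_add_sum_compl T g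
  have h3 : ∑ v ∈ Tᶜ, f v ≤ ∑ v ∈ Tᶜ, g v := Finset.sum_le_sum fun v _ => h v
  omega

/-! ### Gains of single moves in clean positions -/

theorem Clean.gain_two (hU : Clean G U) (h : U' ⊆ U) {a b : V} (hab : a ≠ b) {k : ℕ}
    (hk : wt G U' a + wt G U' b + k ≤ wt G U a + wt G U b) :
    potential G U' + k ≤ potential G U := by
  classical
  refine sum_add_le_sum (hU.wt_mono h) {a, b} ?_
  simpa [Finset.sum_pair hab] using hk

theorem Clean.gain_three (hU : Clean G U) (h : U' ⊆ U) {a b c : V} (hab : a ≠ b) (hac : a ≠ c)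
    (hbc : b ≠ c) {k : ℕ}
    (hk : wt G U' a + wt G U' b + wt G U' c + k ≤ wt G U a + wt G U b + wt G U c) :
    potential G U' + k ≤ potential G U := by
  classical
  refine sum_add_le_sum (hU.wt_mono h) {a, b, c} ?_
  have hs : ∀ f : V → ℕ, ∑ v ∈ {a, b, c}, f v = f a + f b + f c := fun f => by
    rw [Finset.sum_insert (by simp [hab, hac]), Finset.sum_pair hbc, add_assoc]
  rw [hs, hs]
  exact hk

theorem Clean.gain_four (hU : Clean G U) (h : U' ⊆ U) {a b c d : V} (hab : a ≠ b) (hac : a ≠ c)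
    (had : a ≠ d) (hbc : b ≠ c) (hbd : b ≠ d) (hcd : c ≠ d) {k : ℕ}
    (hk : wt G U' a + wt G U' b + wt G U' c + wt G U' d + k ≤
      wt G U a + wt G U b + wt G U c + wt G U d) :
    potential G U' + k ≤ potential G U := by
  classical
  refine sum_add_le_sum (hU.wt_mono h) {a, b, c, d} ?_
  have hs : ∀ f : V → ℕ, ∑ v ∈ {a, b, c, d}, f v = f a + f b + f c + f d := fun f => by
    rw [Finset.sum_insert (by simp [hab, hac, had]), Finset.sum_insert (by simp [hbc, hbd]),
      Finset.sum_pair hcd, add_assoc, add_assoc]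
  rw [hs, hs]
  exact hk

/-- An undominated move loses its own 5, or 4 plus 2 from a neighbor if it is a center. A dominated
move loses 2 and its neighbor `y` loses 3; if `y` is a support it may lose only 2, but then
leafiness makes the move worth at least 3. -/
theorem Clean.stall_gain (hU : Clean G U) (hm : Legal G U m) :
    potential G (after G U m) + 5 ≤ potential G U := by
  by_cases hmU : m ∈ U
  · by_cases hc : IsCenter G U m
    · obtain ⟨a, b, ha, -, -⟩ : ∃ a b, G.Adj m a ∧ G.Adj m b ∧ a ≠ b := by
        have := hc.1
        simp only [IsLeaf] at this
        push Not at this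
        exact this
      refine hU.gain_two after_subset ha.ne ?_
      have h1 := four_le_wt (G := G) hmU
      have h2 := two_le_wt hmU ha.symm
      have h3 : wt G (after G U m) a = 0 := wt_eq_zero (fun h => (mem_after.1 h).2.2 ha)
        fun q hq haq => (mem_after.1 hq).2.1 ((hc.2 a ha).2 q (after_subset hq) haq)
      rw [wt_after_self, h3]
      omega
    · refine sum_add_le_sum (hU.wt_mono after_subset) {m} ?_
      have := wt_after_self (G := G) (U := U) (m := m)
      simp [this, wt_of_mem hmU hc]
  · obtain ⟨y, hy, rfl | ha⟩ := hm
    · exact absurd hy hmU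
    have hy' : y ∉ after G U m := fun h => (mem_after.1 h).2.2 ha
    refine hU.gain_two after_subset ha.ne ?_
    rw [wt_after_self, wt_eq_of_notMem hmU hy ha]
    by_cases hs : IsSupport G U y
    · have := hU.wt_add_two_le after_subset hy hy'
      have := leafiness_pos hy ha (Or.inr hs)
      omega
    · have := hU.wt_add_three_le after_subset hy hy' hs
      omega

/-- Playing a vertex with two undominated neighbors in a clean position. -/
theorem Clean.gain_of_two_adj (hU : Clean G U) {a b : V} (hv : v ∈ U) (ha : a ∈ U)
    (hb : b ∈ U) (hva : G.Adj v a) (hvb : G.Adj v b) (hab : a ≠ b) :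
    potential G (after G U v) + 11 ≤ potential G U := by
  have key : ∀ c ∈ U, G.Adj v c → wt G (after G U v) c + 3 ≤ wt G U c := by
    intro c hc hvc
    refine hU.wt_add_three_le after_subset hc (fun h => (mem_after.1 h).2.2 hvc) ?_
    -- Cleanness would identify `v` with the leaf `z`, but `v` has two neighbors.
    rintro ⟨z, hz, hl, hcz⟩
    obtain rfl := hU c hc z hz hl hcz v hv hvc.symm
    exact hab (hl a b hva hvb)
  refine hU.gain_three after_subset hva.ne hvb.ne hab ?_
  have h1 := key a ha hva
  have h2 := key b hb hvb
  rw [wt_after_self, wt_of_adj hv ha hva]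
  omega

/-! ### Structure of stuck positions -/

variable (G) in
/-- No move decreases the potential by eleven. -/
def Stuck (U : Finset V) : Prop :=
  ∀ m, Legal G U m → potential G U < potential G (after G U m) + 11

theorem Stuck.matched (hs : Stuck G U) (hU : Clean G U) : Matched G U := by
  intro v hv a ha b hb hva hvb
  by_contra hab
  have := hU.gain_of_two_adj hv ha hb hva hvb hab
  have := hs v ⟨v, hv, Or.inl rfl⟩
  omega

theorem Matched.edge_gain (hM : Matched G U) (hU : Clean G U) (hu : u ∈ U) (hv : v ∈ U)
    (huv : G.Adj u v) : potential G (after G U u) + 10 ≤ potential G U := by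
  refine hU.gain_two after_subset huv.ne ?_
  rw [wt_after_self, hM.wt_after_eq_zero hu hv huv, wt_of_adj hu hv huv,
    wt_of_adj hv hu huv.symm]

theorem Matched.edge_gain_of_pendant (hM : Matched G U) (hU : Clean G U) {c : V} (hu : u ∈ U)
    (hv : v ∈ U) (huv : G.Adj u v) (hc : c ∉ U) (hcu : G.Adj c u)
    (h : ∀ q ∈ U, G.Adj c q → q = u ∨ q = v) :
    potential G (after G U u) + 12 ≤ potential G U := by
  have h3 : wt G (after G U u) c = 0 := by
    refine wt_eq_zero (fun h => hc (after_subset h)) fun q hq hcq => ?_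
    have hq' := mem_after.1 hq
    rcases h q hq'.1 hcq with rfl | rfl
    · exact hq'.2.1 rfl
    · exact hq'.2.2 huv
  refine hU.gain_three after_subset huv.ne hcu.ne.symm (fun h => hc (h ▸ hv)) ?_
  have := two_le_wt hu hcu
  rw [wt_after_self, h3, hM.wt_after_eq_zero hu hv huv, wt_of_adj hu hv huv,
    wt_of_adj hv hu huv.symm]
  omega

theorem Stuck.exists_third (hs : Stuck G U) (hU : Clean G U) {c : V} (hu : u ∈ U)
    (hv : v ∈ U) (huv : G.Adj u v) (hc : c ∉ U) (hcu : G.Adj c u) :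
    ∃ q ∈ U, G.Adj c q ∧ q ≠ u ∧ q ≠ v := by
  by_contra! h
  have := (hs.matched hU).edge_gain_of_pendant hU hu hv huv hc hcu
    fun q hq hcq => or_iff_not_imp_left.2 (h q hq hcq)
  have := hs u ⟨u, hu, Or.inl rfl⟩
  omega

theorem Stuck.not_two_isolated (hs : Stuck G U) (hU : Clean G U) {b x y : V}
    (hx : x ∈ U) (hy : y ∈ U) (hbx : G.Adj b x) (hby : G.Adj b y) (hxy : x ≠ y)
    (hx' : ∀ q ∈ U, ¬ G.Adj x q) (hy' : ∀ q ∈ U, ¬ G.Adj y q) : False := by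
  have := hs b ⟨x, hx, Or.inr hbx⟩
  have : potential G (after G U b) + 12 ≤ potential G U := by
    refine hU.gain_three after_subset hbx.ne hby.ne hxy ?_
    rw [wt_after_self, wt_eq_zero (fun h => (mem_after.1 h).2.2 hbx)
      fun q hq => hx' q (after_subset hq), wt_eq_zero (fun h => (mem_after.1 h).2.2 hby)
      fun q hq => hy' q (after_subset hq),
      wt_of_mem hx fun hc => hxy ((hc.2 b hbx.symm).2 y hy hby).symm,
      wt_of_mem hy fun hc => hxy ((hc.2 b hby.symm).2 x hx hbx)]
    have := two_le_wt hx hbx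
    omega
  omega

/-- Playing `v` already removes 10 from `v` and its leaf. With leafiness at most 2 the cap in `wt`
is not active, so `b` would lose the eleventh unit. -/
theorem Stuck.three_le_leafiness (hs : Stuck G U) (hU : Clean G U) {b : V} (hv : v ∈ U)
    (hsv : IsSupport G U v) (hb : b ∉ U) (hbv : G.Adj b v) : 3 ≤ leafiness G U b := by
  classical
  by_contra! hlt
  obtain ⟨z, hz, hl, hvz⟩ := id hsv
  have hpos := leafiness_pos hv hbv (Or.inr hsv)
  have hlt' : leafiness G (after G U v) b < leafiness G U b := by
    refine Finset.card_lt_card ⟨fun q hq => ?_, fun h => ?_⟩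
    · simp only [Finset.mem_filter] at hq ⊢
      exact ⟨after_subset hq.1, hq.2.1, hq.2.2.imp_right (IsSupport.mono after_subset)⟩
    · have := @h v (by simp [hv, hbv, hsv])
      simp only [Finset.mem_filter] at this
      exact (mem_after.1 this.1).2.1 rfl
  have h3 := wt_le_of_notMem (G := G) (U := after G U v) fun h => hb (after_subset h)
  have := hs v ⟨v, hv, Or.inl rfl⟩
  have : potential G (after G U v) + 11 ≤ potential G U := by
    refine hU.gain_three after_subset hvz.ne hbv.ne.symm (fun h => hb (h ▸ hz)) ?_
    rw [wt_after_self, (hs.matched hU).wt_after_eq_zero hv hz hvz, wt_of_adj hv hz hvz,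
      wt_of_adj hz hv hvz.symm, wt_eq_of_notMem hb hv hbv]
    omega
  omega

/-- Here `b` has the full weight 4. If `q` were no support, playing `b` would remove 4 from `b`, 3
from `q` and 2 from each of two further neighbors. -/
theorem Stuck.isSupport (hs : Stuck G U) (hU : Clean G U) {b q : V} (hv : v ∈ U)
    (hsv : IsSupport G U v) (hb : b ∉ U) (hbv : G.Adj b v) (hq : q ∈ U) (hbq : G.Adj b q) :
    IsSupport G U q := by
  classical
  by_contra hsq
  have h3 := hs.three_le_leafiness hU hv hsv hb hbv
  have h2 := Finset.pred_card_le_card_erase (a := q)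
    (s := U.filter fun q => G.Adj b q ∧ (IsLeaf G q ∨ IsSupport G U q))
  obtain ⟨x, hx, y, hy, hxy⟩ := Finset.one_lt_card.1 (lt_of_lt_of_le (Nat.lt_pred_of_succ_lt h3) h2)
  simp only [Finset.mem_erase, Finset.mem_filter] at hx hy
  have hn : ∀ q, G.Adj b q → q ∉ after G U b := fun q h h' => (mem_after.1 h').2.2 h
  have := hs b ⟨v, hv, Or.inr hbv⟩
  have : potential G (after G U b) + 11 ≤ potential G U := by
    refine hU.gain_four after_subset hbq.ne hx.2.2.1.ne hy.2.2.1.ne (Ne.symm hx.1) (Ne.symm hy.1)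
      hxy ?_
    have h4 := hU.wt_add_three_le after_subset hq (hn q hbq) hsq
    have h5 := hU.wt_add_two_le after_subset hx.2.1 (hn x hx.2.2.1)
    have h6 := hU.wt_add_two_le after_subset hy.2.1 (hn y hy.2.2.1)
    rw [wt_after_self, wt_eq_of_notMem hb hv hbv]
    omega
  omega

/-- By `Stuck.isSupport` no undominated neighbor of `b` is a support, so three of them would make
playing `b` remove 2 + 3 + 3 + 3. -/
theorem Stuck.eq_of_adj (hs : Stuck G U) (hU : Clean G U) {b x y z : V} (hb : b ∉ U)
    (hx : x ∈ U) (hy : y ∈ U) (hz : z ∈ U) (hbx : G.Adj b x) (hby : G.Adj b y) (hbz : G.Adj b z)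
    (hsx : ¬ IsSupport G U x) (hxy : x ≠ y) (hxz : x ≠ z) : y = z := by
  by_contra hyz
  have hn : ∀ q ∈ U, G.Adj b q → wt G (after G U b) q + 3 ≤ wt G U q := fun q hq hbq =>
    hU.wt_add_three_le after_subset hq (fun h' => (mem_after.1 h').2.2 hbq)
      fun h => hsx (hs.isSupport hU hq h hb hbq hx hbx)
  have := hs b ⟨x, hx, Or.inr hbx⟩
  have : potential G (after G U b) + 11 ≤ potential G U := by
    refine hU.gain_four after_subset hbx.ne hby.ne hbz.ne hxy hxz hyz ?_
    have h4 := hn x hx hbx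
    have h5 := hn y hy hby
    have h6 := hn z hz hbz
    have := two_le_wt hx hbx
    rw [wt_after_self]
    omega
  omega

/-- Dominating an undominated vertex all of whose neighbors see no other undominated vertex. -/
theorem Clean.gain_of_closed (hU : Clean G U) (hG : IsolateFree G) {x : V} (hx : x ∈ U)
    (h : ∀ c, G.Adj x c → c ∉ U ∧ ∀ q ∈ U, G.Adj c q → q = x) (hm : x = m ∨ G.Adj m x) :
    potential G (after G U m) + 8 ≤ potential G U := by
  have hx' : x ∉ after G U m := fun h => by
    have := mem_after.1 h
    tauto
  have hx0 : wt G (after G U m) x = 0 :=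
    wt_eq_zero hx' fun q hq hxq => (h q hxq).1 (after_subset hq)
  have hc0 : ∀ c, G.Adj x c → wt G (after G U m) c = 0 := fun c hc =>
    wt_eq_zero (fun h' => (h c hc).1 (after_subset h'))
      fun q hq hcq => hx' ((h c hc).2 q (after_subset hq) hcq ▸ hq)
  by_cases hl : IsLeaf G x
  · obtain ⟨c, hc⟩ : ∃ c, G.Adj x c := by
      by_contra! hn
      exact hG x hn
    refine hU.gain_two after_subset hc.ne ?_
    have := leafiness_pos hx hc.symm (Or.inl hl)
    rw [hx0, hc0 c hc, wt_of_mem hx fun h => h.1 hl, wt_eq_of_notMem (h c hc).1 hx hc.symm]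
    omega
  · obtain ⟨a, b, ha, hb, hab⟩ : ∃ a b, G.Adj x a ∧ G.Adj x b ∧ a ≠ b := by
      simp only [IsLeaf] at hl
      push Not at hl
      exact hl
    refine hU.gain_three after_subset ha.ne hb.ne hab ?_
    have := two_le_wt hx ha.symm
    have := two_le_wt hx hb.symm
    have := four_le_wt (G := G) hx
    rw [hx0, hc0 a ha, hc0 b hb]
    omega

theorem Clean.gain_six (hU : Clean G U) {x : V} (hx : x ∈ U) (hxU : ∀ q ∈ U, ¬ G.Adj x q)
    {b : V} (hb : b ∉ U) (hbx : G.Adj b x) (hb' : ∀ q ∈ U, G.Adj b q → q = x)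
    (hm : x = m ∨ G.Adj m x) : potential G (after G U m) + 6 ≤ potential G U := by
  have hx' : x ∉ after G U m := fun h => by
    have := mem_after.1 h
    tauto
  refine hU.gain_two after_subset hbx.ne ?_
  rw [wt_eq_zero hx' fun q hq => hxU q (after_subset hq),
    wt_eq_zero (fun h => hb (after_subset h))
      fun q hq hbq => hx' (hb' q (after_subset hq) hbq ▸ hq)]
  have := four_le_wt (G := G) hx
  have := two_le_wt hx hbx
  omega

/-- When Dominator is stuck and plays an edge, preferably one without leaves, either Staller's
reply decreases the potential by six or Dominator can then decrease it by twelve. -/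
theorem Stuck.reply (hs : Stuck G U) (hU : Clean G U) (hG : IsolateFree G) (hu : u ∈ U)
    (hv : v ∈ U) (huv : G.Adj u v)
    (hE : (¬ IsLeaf G u ∧ ¬ IsLeaf G v) ∨
      ∀ a ∈ U, ∀ c ∈ U, G.Adj a c → IsLeaf G a ∨ IsLeaf G c)
    (hm : Legal G (after G U u) m) :
    potential G (after G (after G U u) m) + 6 ≤ potential G (after G U u) ∨
      ∃ b, Legal G (after G (after G U u) m) b ∧
        potential G (after G (after G (after G U u) m) b) + 12 ≤
          potential G (after G (after G U u) m) := by
  have hM := hs.matched hU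
  have hU1 : ∀ q, q ∈ after G U u ↔ q ∈ U ∧ q ≠ u ∧ q ≠ v := by
    intro q
    rw [mem_after]
    refine and_congr_right fun hq => and_congr_right fun _ => not_congr ⟨fun h => ?_, fun h => ?_⟩
    · exact hM u hu q hq v hv h huv
    · exact h ▸ huv
  -- an undominated neighbor of a remaining vertex remains
  have hmate : ∀ a ∈ after G U u, ∀ q ∈ U, G.Adj a q → q ∈ after G U u := by
    intro a ha q hq haq
    have ha' := (hU1 a).1 ha
    refine (hU1 q).2 ⟨hq, ?_, ?_⟩
    · rintro rfl
      exact ha'.2.2 (hM q hu a ha'.1 v hv haq.symm huv)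
    · rintro rfl
      exact ha'.2.1 (hM q hv a ha'.1 u hu haq.symm huv.symm)
  set U1 := after G U u with hU1def
  have hsub : U1 ⊆ U := after_subset
  have hC1 : Clean G U1 := hU.mono hsub
  have hC2 : Clean G (after G U1 m) := hC1.mono after_subset
  have hnoleaf : ∀ {a b c : V}, G.Adj a b → G.Adj a c → b ≠ c → ¬ IsLeaf G a :=
    fun hab hac hbc hl => hbc (hl _ _ hab hac)
  by_cases hm1 : m ∈ U1
  · by_cases hiso : ∃ a ∈ U1, G.Adj m a
    · obtain ⟨a, ha, hma⟩ := hiso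
      left
      refine hC1.gain_two after_subset hma.ne ?_
      have := hC1.wt_add_two_le after_subset ha fun h => (mem_after.1 h).2.2 hma
      rw [wt_after_self, wt_of_adj hm1 ha hma]
      omega
    push Not at hiso
    have hisoU : ∀ q ∈ U, ¬ G.Adj m q := fun q hq h => hiso q (hmate m hm1 q hq h) h
    obtain ⟨b, hmb⟩ : ∃ b, G.Adj m b := by
      by_contra! hn
      exact hG m hn
    have hbU : b ∉ U := fun h => hisoU b h hmb
    by_cases hp : ∀ q ∈ U1, G.Adj b q → q = m
    · exact Or.inl (hC1.gain_six hm1 hiso (fun h => hbU (hsub h)) hmb.symm hp (Or.inl rfl))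
    push Not at hp
    obtain ⟨y, hy, hby, hym⟩ := hp
    obtain ⟨y', hy', hyy'⟩ : ∃ y' ∈ U, G.Adj y y' := by
      by_contra! hn
      exact hs.not_two_isolated hU (hsub hm1) (hsub hy) hmb.symm hby (Ne.symm hym) hisoU hn
    have hms : ¬ IsSupport G U m := fun ⟨z, hz, _, h⟩ => hisoU z hz h
    right
    have hM2 : Matched G (after G U1 m) := fun a ha c hc d hd =>
      hM a (hsub (after_subset ha)) c (hsub (after_subset hc)) d (hsub (after_subset hd))
    have hy2 : y ∈ after G U1 m := mem_after.2 ⟨hy, hym, hiso y hy⟩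
    have hy'1 := hmate y hy y' hy' hyy'
    have hy'2 : y' ∈ after G U1 m :=
      mem_after.2 ⟨hy'1, fun h => hiso y hy (h ▸ hyy'.symm), hiso y' hy'1⟩
    -- Since `m` is no support, `b` sees only `m` and `y` in `U`. After `m` only `y` is left, so
    -- playing `y` removes the edge `y y'` and also `b`.
    refine ⟨y, ⟨y, hy2, Or.inl rfl⟩, hM2.edge_gain_of_pendant hC2 hy2 hy'2 hyy'
      (fun h => hbU (hsub (after_subset h))) hby fun q hq hbq => Or.inl ?_⟩
    have hq' := mem_after.1 hq
    exact hs.eq_of_adj hU hbU (hsub hm1) (hsub hq'.1) (hsub hy) hmb.symm hbq hby hms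
      (Ne.symm hq'.2.1) (Ne.symm hym)
  obtain ⟨y, hy, rfl | hmy⟩ := hm
  · exact absurd hy hm1
  have hmU : m ∉ U := fun h => hm1 (hmate y hy m h hmy.symm)
  have hyU := hsub hy
  have hy2 : y ∉ after G U1 m := fun h => (mem_after.1 h).2.2 hmy
  by_cases huniq : ∃ x ∈ U1, G.Adj m x ∧ x ≠ y
  · obtain ⟨x, hx, hmx, hxy⟩ := huniq
    left
    refine hC1.gain_three after_subset hmx.ne hmy.ne hxy ?_
    have := hC1.wt_add_two_le after_subset hx fun h => (mem_after.1 h).2.2 hmx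
    have := hC1.wt_add_two_le after_subset hy hy2
    have := two_le_wt hy hmy
    rw [wt_after_self]
    omega
  push Not at huniq
  by_cases hiso : ∃ a ∈ U1, G.Adj y a
  swap
  · push Not at hiso
    exact Or.inl (hC1.gain_six hy hiso hm1 hmy huniq (Or.inr hmy))
  obtain ⟨y', hy', hyy'⟩ := hiso
  have hy'U := hsub hy'
  have hmy' : ¬ G.Adj m y' := fun h => hyy'.ne (huniq y' hy' h).symm
  have hyl : ¬ IsLeaf G y := hnoleaf hmy.symm hyy' fun h => hmU (h ▸ hy'U)
  obtain ⟨q, hqU, hmq, hqy, hqy'⟩ := hs.exists_third hU hyU hy'U hyy' hmU hmy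
  have hquv : q = u ∨ q = v := by
    by_contra! h
    exact hqy (huniq q ((hU1 q).2 ⟨hqU, h.1, h.2⟩) hmq)
  rcases hE with ⟨hul, hvl⟩ | hE
  swap
  -- Every edge has a leaf, so `y'` is one and `y` is a support. Then `m` has leafiness at least 3,
  -- hence sees both `u` and `v`, and neither of them is a leaf.
  · exfalso
    have hys : IsSupport G U y :=
      ⟨y', hy'U, (hE y hyU y' hy'U hyy').resolve_left hyl, hyy'⟩
    have hall : ∀ x ∈ U, G.Adj m x → x = y ∨ x = u ∨ x = v := by
      intro x hx hmx
      by_contra! h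
      exact h.1 (huniq x ((hU1 x).2 ⟨hx, h.2.1, h.2.2⟩) hmx)
    classical
    have h3 := hs.three_le_leafiness hU hyU hys hmU hmy
    have hadj : ∀ a b : V, (∀ x ∈ U, G.Adj m x → x = y ∨ x = a ∨ x = b) → G.Adj m a := by
      intro a b hab
      obtain ⟨x, hx, hx'⟩ := Finset.exists_mem_notMem_of_card_lt_card
        (lt_of_le_of_lt (Finset.card_le_two (a := y) (b := b)) h3)
      simp only [Finset.mem_filter] at hx
      simp only [Finset.mem_insert, Finset.mem_singleton, not_or] at hx'
      rcases hab x hx.1 hx.2.1 with rfl | rfl | rfl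
      · exact absurd rfl hx'.1
      · exact hx.2.1
      · exact absurd rfl hx'.2
    have hmu := hadj u v hall
    have hmv := hadj v u fun x hx h => (hall x hx h).imp_right Or.symm
    rcases hE u hu v hv huv with h | h
    · exact hnoleaf hmu.symm huv (fun h => hmU (h ▸ hv)) h
    · exact hnoleaf hmv.symm huv.symm (fun h => hmU (h ▸ hu)) h
  have hqs : ¬ IsSupport G U q := by
    rcases hquv with rfl | rfl
    · exact hM.not_isSupport hqU hv huv hvl
    · exact hM.not_isSupport hqU hu huv.symm hul
  have hys : ¬ IsSupport G U y := fun h => hqs (hs.isSupport hU hyU h hmU hmy hqU hmq)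
  have hy'l : ¬ IsLeaf G y' := fun h => hys ⟨y', hy'U, h, hyy'⟩
  have hy's : ¬ IsSupport G U y' := hM.not_isSupport hy'U hyU hyy'.symm hyl
  have hy'2 : y' ∈ after G U1 m := mem_after.2 ⟨hy', fun h => hm1 (h ▸ hy'), hmy'⟩
  have hU2U : after G U1 m ⊆ U := after_subset.trans hsub
  have hnbr : ∀ c, G.Adj y' c → c ∉ after G U1 m := fun c hc h =>
    hy2 (hM y' hy'U c (hU2U h) y hyU hc hyy'.symm ▸ h)
  by_cases hc : ∀ c, G.Adj y' c → ∀ q ∈ after G U1 m, G.Adj c q → q = y'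
  · left
    have hcen : IsCenter G (after G U1 m) y' := ⟨hy'l, fun c h => ⟨hnbr c h, hc c h⟩⟩
    -- The gain 6 is 2 from `m`, 3 from `y`, and 1 from `y'` becoming a center.
    refine hC1.gain_three after_subset hmy.ne (fun h => hm1 (h ▸ hy')) hyy'.ne ?_
    have := hC1.wt_add_three_le after_subset hy hy2 fun h => hys (h.mono hsub)
    have := two_le_wt hy hmy
    rw [wt_after_self, wt_of_isCenter hy'2 hcen, wt_of_adj hy' hy hyy'.symm]
    omega
  push Not at hc
  obtain ⟨c, hy'c, p, hp, hcp, hpy'⟩ := hc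
  right
  have hy_nbr : ∀ q ∈ U, G.Adj y q → q = y' := fun q hq h => hM y hyU q hq y' hy'U h hyy'
  have hcy : c ≠ y := by
    rintro rfl
    exact hpy' (hy_nbr p (hU2U hp) hcp)
  have hcU : c ∉ U := fun h => hcy (hM y' hy'U c h y hyU hy'c hyy'.symm)
  have hps : ¬ IsSupport G U p := fun h =>
    hy's (hs.isSupport hU (hU2U hp) h hcU hcp hy'U hy'c.symm)
  -- Playing `c` removes 5 from `y'`, 3 from `p`, and 2 each from `c` and from `y`, whose last
  -- undominated neighbor is `y'`.
  refine ⟨c, ⟨y', hy'2, Or.inr hy'c.symm⟩, ?_⟩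
  have hc2 : c ∉ after G U1 m := hnbr c hy'c
  have hy'3 : y' ∉ after G (after G U1 m) c := fun h => (mem_after.1 h).2.2 hy'c.symm
  refine hC2.gain_four after_subset hy'c.ne.symm hcy hcp.ne hyy'.ne.symm (Ne.symm hpy')
    (fun h => hy2 (h ▸ hp)) ?_
  have h1 := hC2.wt_add_three_le after_subset hp (fun h => (mem_after.1 h).2.2 hcp)
    fun h => hps (h.mono hU2U)
  have h2 := two_le_wt hy'2 hyy'
  have h3 := two_le_wt hy'2 hy'c.symm
  rw [wt_after_self, wt_eq_zero hy'3 fun q hq h => hnbr q h (after_subset hq),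
    wt_eq_zero (fun h => hy2 (after_subset h)) fun q hq h =>
      hy'3 (hy_nbr q (hU2U (after_subset hq)) h ▸ hq),
    wt_of_mem hy'2 fun h => hpy' ((h.2 c hy'c).2 p hp hcp)]
  omega

/-! ### Induction in clean positions -/

/-- A move of Dominator after which the induction hypothesis applies to every reply. -/
theorem domBound_of_move {F : Finset V → ℕ} {g : ℕ} (hm : Legal G U m)
    (hg : F (after G U m) + g ≤ F U) (h8 : 8 ≤ g)
    (hS : ∀ m', Legal G (after G U m) m' →
      ∃ w, DomBound G (after G (after G U m) m') w ∧ w + 16 ≤ F (after G U m) + g) :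
    DomBound G U (F U) := by
  -- `8 ≤ g` secures `8 ≤ F U` even when the move ends the game and no reply exists.
  refine StallBound.domBound (w' := F U - 8) hm (stallBound_of_forall fun m' hm' => ?_) (by omega)
  obtain ⟨w, hw, h⟩ := hS m' hm'
  exact ⟨w, hw, by omega⟩

theorem Clean.domBound (hG : IsolateFree G) (hU : Clean G U) : DomBound G U (potential G U) := by
  induction hn : U.card using Nat.strong_induction_on generalizing U with
  | _ n ih =>
  subst hn
  have ih' : ∀ U' : Finset V, U' ⊆ U → U'.card < U.card → DomBound G U' (potential G U') :=
    fun U' hs hlt => ih _ hlt (hU.mono hs) rfl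
  rcases U.eq_empty_or_nonempty with rfl | hne
  · exact domBound_empty
  by_cases hs : Stuck G U
  swap
  · simp only [Stuck] at hs
    push Not at hs
    obtain ⟨m, hm, hg⟩ := hs
    refine domBound_of_move hm hg (by omega) fun m' hm' =>
      ⟨_, ih' _ (after_subset.trans after_subset) (hm'.card_after_lt.trans hm.card_after_lt), ?_⟩
    have := (hU.mono after_subset).stall_gain hm'
    omega
  have hM := hs.matched hU
  by_cases hedge : ∃ u ∈ U, ∃ v ∈ U, G.Adj u v
  · obtain ⟨u, hu, v, hv, huv, hE⟩ : ∃ u ∈ U, ∃ v ∈ U, G.Adj u v ∧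
        ((¬ IsLeaf G u ∧ ¬ IsLeaf G v) ∨
          ∀ a ∈ U, ∀ c ∈ U, G.Adj a c → IsLeaf G a ∨ IsLeaf G c) := by
      by_cases h : ∀ a ∈ U, ∀ c ∈ U, G.Adj a c → IsLeaf G a ∨ IsLeaf G c
      · obtain ⟨u, hu, v, hv, huv⟩ := hedge
        exact ⟨u, hu, v, hv, huv, Or.inr h⟩
      · push Not at h
        obtain ⟨u, hu, v, hv, huv, h⟩ := h
        exact ⟨u, hu, v, hv, huv, Or.inl h⟩
    have hmu : Legal G U u := ⟨u, hu, Or.inl rfl⟩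
    refine domBound_of_move hmu (hM.edge_gain hU hu hv huv) (by omega) fun m hm => ?_
    have hsub : after G (after G U u) m ⊆ U := after_subset.trans after_subset
    have hlt := hm.card_after_lt.trans hmu.card_after_lt
    rcases hs.reply hU hG hu hv huv hE hm with hg | ⟨b, hb, hg⟩
    · exact ⟨_, ih' _ hsub hlt, by omega⟩
    · have h5 := (hU.mono after_subset).stall_gain hm
      -- The next two moves remove 12 + 5 = 17, one more than their cost 16; this unit makes up for
      -- the first pair, which removed only 10 + 5.
      refine ⟨potential G (after G (after G U u) m) - 1, StallBound.domBound hb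
        (stallBound_of_forall (w := potential G (after G (after G U u) m) - 9) fun m' hm' =>
          ⟨_, ih' _ (after_subset.trans (after_subset.trans hsub))
            (hm'.card_after_lt.trans (hb.card_after_lt.trans hlt)), ?_⟩) ?_, ?_⟩
      · have := (hU.mono (after_subset.trans hsub)).stall_gain hm'
        omega
      · omega
      · omega
  · push Not at hedge
    have hclosed : ∀ x ∈ U, ∀ c, G.Adj x c → c ∉ U ∧ ∀ q ∈ U, G.Adj c q → q = x := by
      refine fun x hx c hxc => ⟨fun h => hedge x hx c h hxc, fun q hq hcq => ?_⟩
      by_contra hqx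
      exact hs.not_two_isolated hU hq hx hcq hxc.symm hqx (hedge q hq) (hedge x hx)
    obtain ⟨m, hm⟩ := exists_legal (G := G) hne
    obtain ⟨x, hx, hmx⟩ := id hm
    refine domBound_of_move hm (hU.gain_of_closed hG hx (hclosed x hx) hmx) le_rfl
      fun m' hm' => ⟨_, ih' _ (after_subset.trans after_subset)
        (hm'.card_after_lt.trans hm.card_after_lt), ?_⟩
    obtain ⟨x', hx', hmx'⟩ := hm'
    have := (hU.mono after_subset).gain_of_closed hG hx' (fun c hc =>
      ⟨fun h => (hclosed x' (after_subset hx') c hc).1 (after_subset h),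
        fun q hq => (hclosed x' (after_subset hx') c hc).2 q (after_subset hq)⟩) hmx'
    omega

/-! ### The opening phase -/

theorem potential_le_coarsePotential : potential G U ≤ coarsePotential G U := by
  refine Finset.sum_le_sum fun v _ => ?_
  simp only [wt, coarseWt]
  split_ifs <;> omega

theorem coarse_stall_gain (hm : Legal G U m) :
    coarsePotential G (after G U m) + 5 ≤ coarsePotential G U := by
  classical
  by_cases hmU : m ∈ U
  · refine sum_add_le_sum (coarseWt_mono after_subset) {m} ?_
    simp [coarseWt_after_self, coarseWt_of_mem hmU]
  · obtain ⟨y, hy, rfl | ha⟩ := hm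
    · exact absurd hy hmU
    refine sum_add_le_sum (coarseWt_mono after_subset) {m, y} ?_
    have := coarseWt_le_four (G := G) fun h : y ∈ after G U m => (mem_after.1 h).2.2 ha
    have h4 : coarseWt G U m = 4 := by
      simp only [coarseWt, hmU, if_false]
      rw [if_pos ⟨y, hy, ha⟩]
    rw [Finset.sum_pair ha.ne, Finset.sum_pair ha.ne, coarseWt_after_self, coarseWt_of_mem hy, h4]
    omega

theorem coarse_gain_of_support {z : V} (hu : u ∈ U) (hz : z ∈ U) (hl : IsLeaf G z)
    (huz : G.Adj u z) (hv : v ∈ U) (huv : G.Adj u v) (hvz : v ≠ z) :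
    coarsePotential G (after G U u) + 11 ≤ coarsePotential G U := by
  classical
  refine sum_add_le_sum (coarseWt_mono after_subset) {u, v, z} ?_
  have hz0 : coarseWt G (after G U u) z = 0 :=
    coarseWt_eq_zero (fun h => (mem_after.1 h).2.2 huz)
      fun q hq hzq => (mem_after.1 hq).2.1 (hl q u hzq huz.symm)
  have := coarseWt_le_four (G := G) fun h : v ∈ after G U u => (mem_after.1 h).2.2 huv
  have hs : ∀ f : V → ℕ, ∑ x ∈ {u, v, z}, f x = f u + (f v + f z) := fun f => by
    rw [Finset.sum_insert (by simp [huv.ne, huz.ne]), Finset.sum_pair hvz]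
  rw [hs, hs, coarseWt_after_self, hz0, coarseWt_of_mem hu, coarseWt_of_mem hv, coarseWt_of_mem hz]
  omega

theorem domBound_coarsePotential (hG : IsolateFree G) (U : Finset V) :
    DomBound G U (coarsePotential G U) := by
  induction hn : U.card using Nat.strong_induction_on generalizing U with
  | _ n ih =>
  subst hn
  by_cases hU : Clean G U
  · exact (hU.domBound hG).mono potential_le_coarsePotential
  simp only [Clean] at hU
  push Not at hU
  obtain ⟨u, hu, z, hz, hl, huz, v, hv, huv, hvz⟩ := hU
  have hm : Legal G U u := ⟨u, hu, Or.inl rfl⟩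
  refine domBound_of_move hm (coarse_gain_of_support hu hz hl huz hv huv hvz) (by omega)
    fun m' hm' => ⟨_, ih _ (hm'.card_after_lt.trans hm.card_after_lt) _ rfl, ?_⟩
  have := coarse_stall_gain hm'
  omega

theorem coarse_first_gain (hG : IsolateFree G) (m : V) :
    coarsePotential G (after G Finset.univ m) + 6 ≤ 5 * Fintype.card V := by
  classical
  obtain ⟨c, hc⟩ : ∃ c, G.Adj m c := by
    by_contra! hn
    exact hG m hn
  have huniv : coarsePotential G (Finset.univ : Finset V) = 5 * Fintype.card V := by
    simp [coarsePotential, coarseWt, mul_comm]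
  rw [← huniv]
  refine sum_add_le_sum (coarseWt_mono after_subset) {m, c} ?_
  have := coarseWt_le_four (G := G) fun h : c ∈ after G Finset.univ m => (mem_after.1 h).2.2 hc
  rw [Finset.sum_pair hc.ne, Finset.sum_pair hc.ne, coarseWt_after_self,
    coarseWt_of_mem (Finset.mem_univ _), coarseWt_of_mem (Finset.mem_univ _)]
  omega

theorem stallBound_univ (hG : IsolateFree G) :
    StallBound G Finset.univ (5 * Fintype.card V + 2) := by
  refine stallBound_of_forall fun m _ => ⟨_, domBound_coarsePotential hG _, ?_⟩
  have := coarse_first_gain hG m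
  omega

end DominationGame

theorem mainTheorem2 {V : Type*} [Fintype V] (G : SimpleGraph V)
    (hG : DominationGame.IsolateFree G) :
    (DominationGame.stallerStartNumber G : ℝ) ≤ (5 * (Fintype.card V : ℝ) + 2) / 8 := by
  have h : 8 * DominationGame.stallerStartNumber G ≤ 5 * Fintype.card V + 2 :=
    DominationGame.stallBound_univ hG ∅ fun v => by simp [DominationGame.dominated]
  rw [le_div_iff₀ (by norm_num), mul_comm]
  exact_mod_cast h
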